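/- For $n \ge 0$, a presentation $\mathcal P$ (of dimension $n$) is a sequence of finite covering maps $q_\ell \colon M_\ell \to M_{\ell-1}$, $\ell \ge 1$, where each $M_\ell$, $\ell \ge 0$, is a compact connected non-empty topological manifold without boundary of dimension $n$. Its solenoidal manifold is the inverse limit $$\mathcal M_{\mathcal P} = \Big\{ (x_\ell)_{\ell \ge 0} \in \prod_{\ell \ge 0} M_\ell \;\Big|\; q_\ell(x_\ell) = x_{\ell-1} \text{ for all } \ell \ge 1 \Big\}$$ with the topology induced from the product topology. Let $m_\ell$ be the degree of the covering $q_\ell$. The Steinitz order of $\mathcal P$ is the Steinitz (supernatural) number $$\xi(\mathcal P) = \operatorname{lcm}\{ m_1 m_2 \cdots m_\ell \mid \ell > 0 \} = \prod_{p \text{ prime}} p^{\chi(p)},$$ where $\chi(p) \in \{0, 1, \ldots, \infty\}$ is the supremum over $\ell$ of the exponent of $p$ in $m_1 \cdots m_\ell$. Put $$\pi_f(\xi(\mathcal P)) = \{ p \mid 0 < \chi(p) < \infty \}, \qquad \pi_\infty(\xi(\mathcal P)) = \{ p \mid \chi(p) = \infty \}.$$ Corollary. Let $\mathcal P$ and $\mathcal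 P'$ be presentations such that $\mathcal M_{\mathcal P}$ and $\mathcal M_{\mathcal P'}$ are homeomorphic. Then $\pi_\infty(\xi(\mathcal P)) = \pi_\infty(\xi(\mathcal P'))$, and $\pi_f(\xi(\mathcal P))$ is infinite if and only if $\pi_f(\xi(\mathcal P'))$ is infinite. -/

import Mathlib

universe u v

noncomputable section

/-! ### Steinitz numbers -/

/-- A Steinitz (supernatural) number `∏ p, p ^ χ p`, given by its characteristic function
`χ` on the set of primes, with values in `{0, 1, …, ∞}`. -/
@[ext]
structure SteinitzNumber where
  χ : Nat.Primes → ℕ∞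

namespace SteinitzNumber

/-- The least common multiple of a family of positive integers: the exponent of a prime `p` is the
supremum of the exponents of `p` in the members of the family. -/
def lcm {ι : Type*} (a : ι → ℕ) : SteinitzNumber where
  χ p := ⨆ i, emultiplicity (p : ℕ) (a i)

/-- The finite prime spectrum: the primes `p` with `0 < χ p < ∞`. -/
def finitePrimeSpectrum (ξ : SteinitzNumber) : Set Nat.Primes :=
  {p | 0 < ξ.χ p ∧ ξ.χ p < ⊤}

/-- The infinite prime spectrum: the primes `p` with `χ p = ∞`. -/
def infinitePrimeSpectrum (ξ : SteinitzNumber) : Set Nat.Primes :=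
  {p | ξ.χ p = ⊤}

end SteinitzNumber

/-! ### Covering degree -/

/-- The number of sheets of a covering map onto a connected space, i.e. the number of points in a
fiber. All fibers have the same number of points, see `IsCoveringMap.card_fiber_eq_coveringDegree`,
so the choice of the fiber is immaterial. -/
def coveringDegree {E X : Type*} [Nonempty X] (f : E → X) : ℕ :=
  Nat.card (f ⁻¹' {Classical.arbitrary X})

theorem IsCoveringMap.card_fiber_eq_coveringDegree {E X : Type*} [TopologicalSpace E]
    [TopologicalSpace X] [ConnectedSpace X] {f : E → X} (hf : IsCoveringMap f) (x : X) :
    Nat.card (f ⁻¹' {x}) = coveringDegree f := by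
  have hloc : IsLocallyConstant fun x : X => Nat.card (f ⁻¹' {x}) := by
    rw [IsLocallyConstant.iff_exists_open]
    intro x
    obtain ⟨hd, U, hxU, hU, hfU, H, hH⟩ := hf x
    refine ⟨U, hU, hxU, fun y hy => ?_⟩
    have hy' : IsEvenlyCovered f y (f ⁻¹' {x}) := ⟨hd, U, hy, hU, hfU, H, hH⟩
    exact (Nat.card_congr hy'.fiberHomeomorph.toEquiv).symm
  exact hloc.apply_eq_of_isPreconnected isPreconnected_univ (Set.mem_univ _) (Set.mem_univ _)

/-! ### Presentations and solenoidal manifolds -/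

/-- A presentation: a sequence `M 0 ← M 1 ← M 2 ← ⋯` of finite covering maps between compact
connected (in particular nonempty) topological manifolds without boundary of dimension `n`.
The maps are automatically proper, as the spaces are compact and Hausdorff; second countability
of `M l` follows from compactness. -/
structure SolenoidPresentation (n : ℕ) where
  M : ℕ → Type u
  [topologicalSpace : ∀ l, TopologicalSpace (M l)]
  [t2Space : ∀ l, T2Space (M l)]
  [compactSpace : ∀ l, CompactSpace (M l)]
  [connectedSpace : ∀ l, ConnectedSpace (M l)]
  [chartedSpace : ∀ l, ChartedSpace (EuclideanSpace ℝ (Fin n)) (M l)]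
  /-- The bonding map `q l` goes from `M (l + 1)` to `M l`. -/
  q : ∀ l, M (l + 1) → M l
  isCoveringMap_q : ∀ l, IsCoveringMap (q l)
  finite_fiber : ∀ l (x : M l), (q l ⁻¹' {x}).Finite

namespace SolenoidPresentation

attribute [instance] topologicalSpace t2Space compactSpace connectedSpace chartedSpace

variable {n : ℕ} (P : SolenoidPresentation.{u} n)

/-- The solenoidal manifold (weak solenoid) of a presentation: the inverse limit of the bonding
maps, with the topology induced from the product topology. -/
abbrev Solenoid : Type u :=
  {x : ∀ l, P.M l // ∀ l, P.q l (x (l + 1)) = x l}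

/-- The degree of the composite covering map `M l → M 0`, as the product of the degrees of
the bonding maps. -/
def totalDegree (l : ℕ) : ℕ :=
  ∏ i ∈ Finset.range l, coveringDegree (P.q i)

/-- The Steinitz order of a presentation: the least common multiple of the degrees of the covering
maps `M l → M 0`. -/
def steinitzOrder : SteinitzNumber :=
  SteinitzNumber.lcm P.totalDegree

end SolenoidPresentation

end

/-! It suffices to find `c > 0` such that each `P.totalDegree l` divides `c * P'.totalDegree k` for
some `k` (`exists_totalDegree_dvd`), and symmetrically. The exponent of a prime then grows by at
most its exponent in `c`, which is finite, and zero for all but finitely many primes.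

Over a simply connected, locally path-connected open set of the base, a solenoid splits into
plaques, the images of sections, and points can be transported along plaques into a single fiber.
Let `h` be the homeomorphism. For large `l`, the image under `h` of each fiber over `M l` lies over
one small plaque domain. The number `N` of level-`k` plaques it meets is locally constant in the
point of `M l`, because `h` carries small plaques into plaques; as `M l` is connected, `N` is
constant (`exists_ncard_transport_eq`).

Near a point `s`, choose a relatively clopen piece `T` of a fiber that `h` followed by transport
maps bijectively onto the fiber through `h s` over some level `k₂`. At level `k` this image has
`P'.totalDegree k / P'.totalDegree k₂` points. For large `k` it also has `N` times as many points as
`T` has at level `l`, and the latter number is a multiple of `P.totalDegree l / P.totalDegree l₁`.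
Hence the divisibility, with `c = P.totalDegree l₁`. -/

noncomputable section

open Topology Set

/-! ### Plaque domains in a compact manifold -/

/-- Open sets over which a tower of covering maps has sections through every point. -/
structure IsPlaqueDomain {X : Type*} [TopologicalSpace X] (V : Set X) : Prop where
  isOpen : IsOpen V
  simplyConnected : SimplyConnectedSpace V
  locallyPathConnected : LocallyPathConnectedSpace V

theorem exists_isPlaqueDomain_subset {n : ℕ} {X : Type*} [TopologicalSpace X]
    [ChartedSpace (EuclideanSpace ℝ (Fin n)) X] (x : X) {U : Set X} (hU : U ∈ 𝓝 x) :
    ∃ V, IsPlaqueDomain V ∧ x ∈ V ∧ V ⊆ U := by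
  let e := chartAt (EuclideanSpace ℝ (Fin n)) x
  have hx : x ∈ e.source := mem_chart_source _ x
  have h1 : e.target ∩ e.symm ⁻¹' U ∈ 𝓝 (e x) := by
    refine Filter.inter_mem (e.open_target.mem_nhds (e.map_source hx)) ?_
    refine e.symm.continuousAt (e.map_source hx) ?_
    rwa [e.left_inv hx]
  obtain ⟨r, hr, hb⟩ := Metric.mem_nhds_iff.1 h1
  have hs : Metric.ball (e x) r ⊆ e.symm.source := fun z hz => (hb hz).1
  let H := e.symm.homeomorphOfImageSubsetSource hs rfl
  have hopen : IsOpen (e.symm '' Metric.ball (e x) r) :=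
    e.symm.isOpen_image_of_subset_source Metric.isOpen_ball hs
  refine ⟨_, ⟨hopen, ?_, ?_⟩, ⟨e x, Metric.mem_ball_self hr, e.left_inv hx⟩, ?_⟩
  · have : ContractibleSpace (Metric.ball (e x) r) :=
      (convex_ball _ _).contractibleSpace ⟨_, Metric.mem_ball_self hr⟩
    have : ContractibleSpace (e.symm '' Metric.ball (e x) r) := H.symm.contractibleSpace
    infer_instance
  · have := ChartedSpace.locallyPathConnectedSpace (EuclideanSpace ℝ (Fin n)) X
    exact hopen.locallyPathConnectedSpace
  · rintro _ ⟨z, hz, rfl⟩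
    exact (hb hz).2

/-- Take sets small for an entourage `E` with `E ○ E` inside a Lebesgue entourage of the cover by
plaque domains: two such sets that meet lie in a common plaque domain, where their plaques can be
compared. A second Lebesgue argument gives `R`, which detects when a whole subset fits into one
member. -/
theorem exists_fine_family_isPlaqueDomain (n : ℕ) (X : Type*) [TopologicalSpace X] [T2Space X]
    [CompactSpace X] [ChartedSpace (EuclideanSpace ℝ (Fin n)) X] :
    ∃ 𝒲 : Set (Set X), (∀ W ∈ 𝒲, IsPlaqueDomain W) ∧
      (∀ x, ∀ U ∈ 𝓝 x, ∃ W ∈ 𝒲, x ∈ W ∧ W ⊆ U) ∧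
      (∀ W₁ ∈ 𝒲, ∀ W₂ ∈ 𝒲, (W₁ ∩ W₂).Nonempty → ∃ V, IsPlaqueDomain V ∧ W₁ ⊆ V ∧ W₂ ⊆ V) ∧
      ∃ R : Set (X × X), IsOpen R ∧ (∀ x, (x, x) ∈ R) ∧
        ∀ x, ∃ W ∈ 𝒲, ∀ y, (x, y) ∈ R → y ∈ W := by
  let _ : UniformSpace X := uniformSpaceOfCompactR1
  obtain ⟨D, hD, hDV⟩ := lebesgue_number_lemma (K := (univ : Set X)) isCompact_univ
    (U := fun V : {V : Set X // IsPlaqueDomain V} => V.1) (fun V => V.2.isOpen)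
    (fun x _ => by
      obtain ⟨V, hV, hx, -⟩ := exists_isPlaqueDomain_subset (n := n) x Filter.univ_mem
      exact mem_iUnion.2 ⟨⟨V, hV⟩, hx⟩)
  obtain ⟨E, hE, hEsymm, hED⟩ := comp_symm_mem_uniformity_sets hD
  let 𝒲 : Set (Set X) := {W | IsPlaqueDomain W ∧ ∀ a ∈ W, ∀ b ∈ W, (a, b) ∈ E}
  have hbasis : ∀ x, ∀ U ∈ 𝓝 x, ∃ W ∈ 𝒲, x ∈ W ∧ W ⊆ U := by
    intro x U hU
    obtain ⟨F, hF, hFsymm, hFE⟩ := comp_symm_mem_uniformity_sets hE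
    obtain ⟨V, hV, hx, hVU⟩ := exists_isPlaqueDomain_subset (n := n) x
      (Filter.inter_mem hU (UniformSpace.ball_mem_nhds x hF))
    refine ⟨V, ⟨hV, fun a ha b hb => hFE ?_⟩, hx, fun z hz => (hVU hz).1⟩
    exact ⟨x, SetRel.symm F (hVU ha).2, (hVU hb).2⟩
  refine ⟨𝒲, fun W hW => hW.1, hbasis, ?_, ?_⟩
  · rintro W₁ hW₁ W₂ hW₂ ⟨z, hz₁, hz₂⟩
    obtain ⟨V, hV⟩ := hDV z (mem_univ _)
    refine ⟨V.1, V.2, fun a ha => hV (hED ⟨z, ?_, ?_⟩), fun a ha => hV (hED ⟨z, ?_, ?_⟩)⟩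
    · exact refl_mem_uniformity hE
    · exact hW₁.2 _ hz₁ _ ha
    · exact refl_mem_uniformity hE
    · exact hW₂.2 _ hz₂ _ ha
  · obtain ⟨F, hF, hFW⟩ := lebesgue_number_lemma (K := (univ : Set X)) isCompact_univ
      (U := fun W : 𝒲 => W.1) (fun W => W.2.1.isOpen)
      (fun x _ => by
        obtain ⟨W, hW, hx, -⟩ := hbasis x univ Filter.univ_mem
        exact mem_iUnion.2 ⟨⟨W, hW⟩, hx⟩)
    refine ⟨interior F, isOpen_interior, fun x => ?_, fun x => ?_⟩
    · exact refl_mem_uniformity (interior_mem_uniformity hF)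
    · obtain ⟨W, hW⟩ := hFW x (mem_univ _)
      exact ⟨W.1, W.2, fun y hy => hW (show (x, y) ∈ F from (interior_subset (s := F) hy))⟩

/-! ### Compactness and counting -/

/-- In a compact space separated by a tower of continuous maps `π k`, every neighbourhood of the
diagonal contains the kernel relation of some `π k`. -/
theorem exists_forall_eq_imp_mem {K : Type*} [TopologicalSpace K] [CompactSpace K] {X : ℕ → Type*}
    [∀ k, TopologicalSpace (X k)] [∀ k, T2Space (X k)] (π : ∀ k, K → X k)
    (hπ : ∀ k, Continuous (π k))
    (hmono : ∀ k c c', π (k + 1) c = π (k + 1) c' → π k c = π k c')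
    (R : Set (K × K)) (hR : IsOpen R) (hdiag : ∀ c c', (∀ k, π k c = π k c') → (c, c') ∈ R) :
    ∃ k₀, ∀ k ≥ k₀, ∀ c c', π k c = π k c' → (c, c') ∈ R := by
  by_contra! hcon
  let Z : ℕ → Set (K × K) := fun k => {p | π k p.1 = π k p.2} ∩ Rᶜ
  have hZmono : ∀ k, Z (k + 1) ⊆ Z k := fun k p hp => ⟨hmono k _ _ hp.1, hp.2⟩
  have hanti : Antitone Z := antitone_nat_of_succ_le hZmono
  have hclosed : ∀ k, IsClosed (Z k) := fun k =>
    (isClosed_eq ((hπ k).comp continuous_fst) ((hπ k).comp continuous_snd)).inter hR.isClosed_compl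
  obtain ⟨p, hp⟩ := IsCompact.nonempty_iInter_of_sequence_nonempty_isCompact_isClosed Z hZmono
    (fun k => by
      obtain ⟨k', hk', c, c', h1, h2⟩ := hcon k
      exact ⟨(c, c'), hanti hk' ⟨h1, h2⟩⟩) (hclosed 0).isCompact hclosed
  rw [mem_iInter] at hp
  exact (hp 0).2 (hdiag _ _ fun k => (hp k).1)

theorem ncard_image_eq_of_eq_iff {γ α β : Type*} (T : Set γ) (f : γ → α) (g : γ → β)
    (h : ∀ c ∈ T, ∀ c' ∈ T, f c = f c' ↔ g c = g c') : (f '' T).ncard = (g '' T).ncard := by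
  classical
  refine Set.ncard_congr (fun a ha => g ha.choose) ?_ ?_ ?_
  · intro a ha
    exact ⟨_, ha.choose_spec.1, rfl⟩
  · intro a b ha hb hab
    rw [← ha.choose_spec.2, ← hb.choose_spec.2]
    exact (h _ ha.choose_spec.1 _ hb.choose_spec.1).2 hab
  · rintro _ ⟨c, hc, rfl⟩
    have hex : ∃ c', c' ∈ T ∧ f c' = f c := ⟨c, hc, rfl⟩
    exact ⟨f c, ⟨c, hc, rfl⟩, (h _ hex.choose_spec.1 _ hc).1 hex.choose_spec.2⟩

/-- Counting along a map `α '' T → β '' T` all of whose fibers have `d` elements. -/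
theorem ncard_image_eq_mul {γ α β : Type*} (T : Set γ) (f : γ → α) (g : γ → β) (d : ℕ)
    (hfin : (f '' T).Finite) (h : ∀ c ∈ T, ∀ c' ∈ T, f c = f c' → g c = g c')
    (hd : ∀ b ∈ g '' T, (f '' (T ∩ g ⁻¹' {b})).ncard = d) :
    (f '' T).ncard = (g '' T).ncard * d := by
  classical
  by_cases hT : T.Nonempty
  · obtain ⟨c₀, -⟩ := hT
    let r : α → β := fun a => if ha : ∃ c ∈ T, f c = a then g ha.choose else g c₀
    have hr : ∀ c ∈ T, r (f c) = g c := fun c hc => by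
      have hex : ∃ c' ∈ T, f c' = f c := ⟨c, hc, rfl⟩
      simp only [r, dif_pos hex]
      exact h _ hex.choose_spec.1 _ hc hex.choose_spec.2
    have him : g '' T = r '' (f '' T) := by
      rw [image_image]
      exact image_congr fun c hc => (hr c hc).symm
    have hfin' : (g '' T).Finite := by rw [him]; exact hfin.image r
    rw [ncard_eq_toFinset_card _ hfin, ncard_eq_toFinset_card _ hfin']
    rw [Finset.card_eq_sum_card_fiberwise (f := r) (t := hfin'.toFinset)]
    · rw [Finset.sum_const_nat (m := d)]
      intro b hb
      rw [← hd b (hfin'.mem_toFinset.1 hb), ← ncard_coe_finset]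
      congr 1
      ext a
      simp only [Finset.coe_filter, Finite.mem_toFinset, mem_ofPred_eq, mem_image, mem_inter_iff,
        mem_preimage, mem_singleton_iff]
      constructor
      · rintro ⟨⟨c, hc, rfl⟩, hb⟩
        exact ⟨c, ⟨hc, (hr c hc).symm.trans hb⟩, rfl⟩
      · rintro ⟨c, ⟨hc, hcb⟩, rfl⟩
        exact ⟨⟨c, hc, rfl⟩, (hr c hc).trans hcb⟩
    · intro a ha
      simp only [Finite.coe_toFinset] at ha ⊢
      exact him ▸ mem_image_of_mem r ha
  · rw [not_nonempty_iff_eq_empty] at hT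
    simp [hT]

/-! ### Degrees, lifting and fibers -/

namespace SolenoidPresentation

variable {n : ℕ} (P : SolenoidPresentation.{u} n)

theorem coveringDegree_pos (l : ℕ) : 0 < coveringDegree (P.q l) := by
  obtain ⟨x⟩ := (inferInstance : Nonempty (P.M (l + 1)))
  rw [← (P.isCoveringMap_q l).card_fiber_eq_coveringDegree (P.q l x)]
  have := (P.finite_fiber l (P.q l x)).to_subtype
  have : Nonempty (P.q l ⁻¹' {P.q l x}) := ⟨⟨x, rfl⟩⟩
  exact Nat.card_pos

theorem totalDegree_pos (l : ℕ) : 0 < P.totalDegree l :=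
  Finset.prod_pos fun i _ => P.coveringDegree_pos i

theorem totalDegree_succ (l : ℕ) :
    P.totalDegree (l + 1) = P.totalDegree l * coveringDegree (P.q l) :=
  Finset.prod_range_succ _ _

theorem surjective_q (l : ℕ) : Function.Surjective (P.q l) := by
  intro x
  have h := P.coveringDegree_pos l
  rw [← (P.isCoveringMap_q l).card_fiber_eq_coveringDegree x] at h
  obtain ⟨⟨y, hy⟩⟩ := (Nat.card_pos_iff.1 h).1
  exact ⟨y, hy⟩

/-- The composite projection to the base of the tower. -/
def toBase : ∀ l, P.M l → P.M 0
  | 0 => id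
  | l + 1 => toBase l ∘ P.q l

/-- A local homeomorphism suffices for uniqueness of lifts from the base; existence is obtained one
covering at a time. -/
theorem isLocalHomeomorph_toBase : ∀ l, IsLocalHomeomorph (P.toBase l)
  | 0 => (Homeomorph.refl _).isLocalHomeomorph
  | l + 1 => (isLocalHomeomorph_toBase l).comp (P.isCoveringMap_q l).isLocalHomeomorph

theorem continuous_toBase (l : ℕ) : Continuous (P.toBase l) :=
  (P.isLocalHomeomorph_toBase l).continuous

variable {P}

theorem toBase_coe (t : P.Solenoid) : ∀ l, P.toBase l (t.1 l) = t.1 0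
  | 0 => rfl
  | l + 1 => by
    change P.toBase l (P.q l (t.1 (l + 1))) = _
    rw [t.2 l, toBase_coe t l]

theorem coe_eq_of_le {t t' : P.Solenoid} {k l : ℕ} (hkl : k ≤ l) (h : t.1 l = t'.1 l) :
    t.1 k = t'.1 k := by
  induction l, hkl using Nat.le_induction with
  | base => exact h
  | succ l _ ih => exact ih (by rw [← t.2, ← t'.2, h])

@[fun_prop]
theorem continuous_coe_apply (l : ℕ) : Continuous fun t : P.Solenoid => t.1 l :=
  (continuous_apply l).comp continuous_subtype_val

theorem continuous_q (l : ℕ) : Continuous (P.q l) := (P.isCoveringMap_q l).continuous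

instance compactSpace_solenoid : CompactSpace P.Solenoid := by
  have hrange : range (Subtype.val : P.Solenoid → ∀ l, P.M l)
      = ⋂ l, {x : ∀ l, P.M l | P.q l (x (l + 1)) = x l} := by
    ext
    simp
  refine IsClosedEmbedding.compactSpace (f := (Subtype.val : P.Solenoid → ∀ l, P.M l))
    ⟨IsEmbedding.subtypeVal, hrange ▸ isClosed_iInter fun l => ?_⟩
  exact isClosed_eq ((continuous_q l).comp (continuous_apply _)) (continuous_apply _)

section Lifting

variable {A : Type*} [TopologicalSpace A]

theorem eq_of_toBase_eq [PreconnectedSpace A] {l : ℕ} {f g : A → P.M l} (hf : Continuous f)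
    (hg : Continuous g) (h : ∀ a, P.toBase l (f a) = P.toBase l (g a)) (a₀ : A)
    (h₀ : f a₀ = g a₀) : f = g :=
  (T2Space.isSeparatedMap _).eq_of_comp_eq (P.isLocalHomeomorph_toBase l).isLocallyInjective
    hf hg (funext h) a₀ h₀

/-- Two lifts to the solenoid of the same map agree at level `l` as soon as they do at a point. -/
theorem coe_eq_of_lift_eq [PreconnectedSpace A] {f g : A → P.Solenoid} (hf : Continuous f)
    (hg : Continuous g) (h : ∀ a, (f a).1 0 = (g a).1 0) {l : ℕ} {a₀ : A}
    (h₀ : (f a₀).1 l = (g a₀).1 l) (a : A) : (f a).1 l = (g a).1 l := by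
  refine congrFun (eq_of_toBase_eq (f := fun a => (f a).1 l) (g := fun a => (g a).1 l)
    ((continuous_coe_apply l).comp hf) ((continuous_coe_apply l).comp hg) (fun a => ?_) a₀ h₀) a
  rw [toBase_coe, toBase_coe, h]

theorem exists_lift_zero [SimplyConnectedSpace A] [LocallyPathConnectedSpace A]
    (f : C(A, P.M 0)) (a₀ : A) (t : P.Solenoid) (h₀ : t.1 0 = f a₀) :
    ∃ g : A → P.Solenoid, Continuous g ∧ (∀ a, (g a).1 0 = f a) ∧ g a₀ = t := by
  have step : ∀ l (g : {g : C(A, P.M l) // g a₀ = t.1 l}),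
      ∃ g' : {g : C(A, P.M (l + 1)) // g a₀ = t.1 (l + 1)}, ∀ a, P.q l (g'.1 a) = g.1 a := by
    intro l g
    obtain ⟨g', ⟨h1, h2⟩, -⟩ := (P.isCoveringMap_q l).existsUnique_continuousMap_lifts g.1 a₀
      (t.1 (l + 1)) ((t.2 l).trans g.2.symm)
    exact ⟨⟨g', h1⟩, congrFun h2⟩
  choose next hnext using step
  let G : ∀ l, {g : C(A, P.M l) // g a₀ = t.1 l} := fun l =>
    Nat.rec (motive := fun l => {g : C(A, P.M l) // g a₀ = t.1 l}) ⟨f, h₀.symm⟩ next l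
  refine ⟨fun a => ⟨fun l => (G l).1 a, fun l => hnext l (G l) a⟩, ?_, fun a => rfl, ?_⟩
  · exact Continuous.subtype_mk (continuous_pi fun l => (G l).1.continuous) _
  · exact Subtype.ext (funext fun l => (G l).2)

/-- Push `f` down to the base, lift from there, and recognise the level-`l` coordinate of the lift
as `f` by uniqueness. -/
theorem exists_lift [SimplyConnectedSpace A] [LocallyPathConnectedSpace A] {l : ℕ}
    {f : A → P.M l} (hf : Continuous f) (a₀ : A) (t : P.Solenoid) (h₀ : t.1 l = f a₀) :
    ∃ g : A → P.Solenoid, Continuous g ∧ (∀ a, (g a).1 l = f a) ∧ g a₀ = t := by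
  obtain ⟨g, hg, hgf, hgt⟩ := exists_lift_zero (P := P)
    ⟨fun a => P.toBase l (f a), (P.continuous_toBase l).comp hf⟩ a₀ t
    (by rw [← toBase_coe t l, h₀]; rfl)
  refine ⟨g, hg, congrFun (eq_of_toBase_eq (f := fun a => (g a).1 l)
    ((continuous_coe_apply l).comp hg) hf
    (fun a => ?_) a₀ (by simp only [hgt, h₀])), hgt⟩
  rw [toBase_coe, hgf]
  rfl

end Lifting

instance nonempty_solenoid : Nonempty P.Solenoid := by
  choose r hr using P.surjective_q
  let x : ∀ l, P.M l := fun l =>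
    Nat.rec (motive := fun l => P.M l) (Classical.arbitrary _) (fun l y => r l y) l
  exact ⟨⟨x, fun l => hr l (x l)⟩⟩

/-- `M l` is path-connected, so a path from the level-`l` coordinate of any thread to `y` lifts to
the solenoid and ends over `y`. -/
theorem exists_coe_eq (l : ℕ) (y : P.M l) : ∃ t : P.Solenoid, t.1 l = y := by
  have := ChartedSpace.locallyPathConnectedSpace (EuclideanSpace ℝ (Fin n)) (P.M l)
  have : PathConnectedSpace (P.M l) := pathConnectedSpace_iff_connectedSpace.2 inferInstance
  obtain ⟨s⟩ := (inferInstance : Nonempty P.Solenoid)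
  let γ := PathConnectedSpace.somePath (s.1 l) y
  obtain ⟨g, -, hg, -⟩ := exists_lift γ.continuous_extend (0 : ℝ) s γ.extend_zero.symm
  exact ⟨g 1, (hg 1).trans γ.extend_one⟩

/-- Every fiber of `M k → M l` has `totalDegree k / totalDegree l` points. -/
theorem ncard_fiber {l k : ℕ} (hlk : l ≤ k) (y : P.M l) :
    ((fun t : P.Solenoid => t.1 k) '' {t | t.1 l = y}).Finite ∧
    ((fun t : P.Solenoid => t.1 k) '' {t | t.1 l = y}).ncard * P.totalDegree l
      = P.totalDegree k := by
  induction k, hlk using Nat.le_induction with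
  | base =>
    have : (fun t : P.Solenoid => t.1 l) '' {t | t.1 l = y} = {y} := by
      ext z
      constructor
      · rintro ⟨t, ht, rfl⟩
        exact ht
      · rintro rfl
        exact exists_coe_eq l z |>.imp fun t ht => ⟨ht, ht⟩
    rw [this]
    simp
  | succ k hlk ih =>
    have hfin : ((fun t : P.Solenoid => t.1 (k + 1)) '' {t | t.1 l = y}).Finite := by
      refine (ih.1.biUnion fun z _ => P.finite_fiber k z).subset ?_
      rintro _ ⟨t, ht, rfl⟩
      exact mem_biUnion ⟨t, ht, rfl⟩ (t.2 k)
    refine ⟨hfin, ?_⟩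
    rw [ncard_image_eq_mul {t : P.Solenoid | t.1 l = y} (fun t => t.1 (k + 1)) (fun t => t.1 k)
      (coveringDegree (P.q k)) hfin (fun t _ t' _ h => coe_eq_of_le k.le_succ h), mul_right_comm,
      ih.2, totalDegree_succ]
    rintro z ⟨s, hs, rfl⟩
    rw [← (P.isCoveringMap_q k).card_fiber_eq_coveringDegree (s.1 k), Nat.card_coe_set_eq]
    congr 1
    ext w
    constructor
    · rintro ⟨t, ⟨-, ht⟩, rfl⟩
      exact (t.2 k).trans ht
    · intro hw
      obtain ⟨t, rfl⟩ := exists_coe_eq (k + 1) w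
      have hts : t.1 k = s.1 k := (t.2 k).symm.trans hw
      exact ⟨t, ⟨(coe_eq_of_le hlk hts).trans hs, hts⟩, rfl⟩

end SolenoidPresentation

/-! ### Plaques and transport along them -/

namespace SolenoidPresentation

variable {n : ℕ} {P : SolenoidPresentation.{u} n}

/-- The points `t` and `t'` lie on the image of a section of `P.Solenoid → P.M 0` over `V`. -/
def SamePlaque (V : Set (P.M 0)) (t t' : P.Solenoid) : Prop :=
  ∃ g : V → P.Solenoid, Continuous g ∧ (∀ v, (g v).1 0 = v) ∧ (∃ a, g a = t) ∧ ∃ b, g b = t'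

theorem SamePlaque.symm {V : Set (P.M 0)} {t t' : P.Solenoid} (h : SamePlaque V t t') :
    SamePlaque V t' t := by
  obtain ⟨g, hg, hg0, ha, hb⟩ := h
  exact ⟨g, hg, hg0, hb, ha⟩

theorem SamePlaque.mem_left {V : Set (P.M 0)} {t t' : P.Solenoid} (h : SamePlaque V t t') :
    t.1 0 ∈ V := by
  obtain ⟨g, hg, hg0, ⟨a, rfl⟩, hb⟩ := h
  rw [hg0]
  exact a.2

theorem SamePlaque.mem_right {V : Set (P.M 0)} {t t' : P.Solenoid} (h : SamePlaque V t t') :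
    t'.1 0 ∈ V :=
  h.symm.mem_left

end SolenoidPresentation

namespace IsPlaqueDomain

open SolenoidPresentation

variable {n : ℕ} {P : SolenoidPresentation.{u} n}

theorem preconnectedSpace {X : Type*} [TopologicalSpace X] {V : Set X} (hV : IsPlaqueDomain V) :
    PreconnectedSpace V := by
  have := hV.simplyConnected
  infer_instance

/-- Sections over a plaque domain of some level through any point. -/
theorem exists_section {l : ℕ} {V : Set (P.M l)} (hV : IsPlaqueDomain V) (t : P.Solenoid)
    (ht : t.1 l ∈ V) : ∃ g : V → P.Solenoid, Continuous g ∧ (∀ v, (g v).1 l = v) ∧ g ⟨_, ht⟩ = t :=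
  have := hV.simplyConnected
  have := hV.locallyPathConnected
  exists_lift continuous_subtype_val ⟨_, ht⟩ t rfl

variable {V : Set (P.M 0)} (hV : IsPlaqueDomain V)
include hV

theorem exists_samePlaque (t : P.Solenoid) (ht : t.1 0 ∈ V) {w : P.M 0} (hw : w ∈ V) :
    ∃ t', t'.1 0 = w ∧ SamePlaque V t t' := by
  obtain ⟨g, hg, hg0, hgt⟩ := hV.exists_section t ht
  exact ⟨g ⟨w, hw⟩, hg0 _, g, hg, hg0, ⟨_, hgt⟩, ⟨_, rfl⟩⟩

/-- Uniqueness of lifts over the connected set `V`, applied at level `k`. Every later comparison of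
plaques reduces to this. -/
theorem coe_eq_of_samePlaque {t t' s s' : P.Solenoid} (h : SamePlaque V t t')
    (h' : SamePlaque V s s') {k : ℕ} (hts : t.1 k = s.1 k) (h0 : t'.1 0 = s'.1 0) :
    t'.1 k = s'.1 k := by
  have := hV.preconnectedSpace
  obtain ⟨f, hf, hf0, ⟨a, rfl⟩, ⟨b, rfl⟩⟩ := h
  obtain ⟨g, hg, hg0, ⟨a', rfl⟩, ⟨b', rfl⟩⟩ := h'
  have haa : a = a' := Subtype.ext (by rw [← hf0, ← hg0]; exact coe_eq_of_le k.zero_le hts)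
  have hbb : b = b' := Subtype.ext (by rw [← hf0, ← hg0]; exact h0)
  subst haa hbb
  exact coe_eq_of_lift_eq hf hg (fun v => (hf0 v).trans (hg0 v).symm) hts b

theorem samePlaque_trans {t t' s : P.Solenoid} (h : SamePlaque V t t') (h' : SamePlaque V t' s) :
    SamePlaque V t s := by
  obtain ⟨u, hu0, hu⟩ := hV.exists_samePlaque t h.mem_left h'.mem_right
  obtain ⟨g, hg, hg0, ⟨a, rfl⟩, ⟨b, rfl⟩⟩ := h
  refine ⟨g, hg, hg0, ⟨a, rfl⟩, ⟨⟨s.1 0, h'.mem_right⟩, ?_⟩⟩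
  refine Subtype.ext (funext fun k => ?_)
  exact hV.coe_eq_of_samePlaque ⟨g, hg, hg0, ⟨b, rfl⟩, ⟨_, rfl⟩⟩ h' rfl (hg0 _)

/-- The section through `f a`, composed with the projection of `f` to `V`, is a lift of the same map
as `f` and agrees with it at `a`. Applied to `h` composed with a section, this shows that
homeomorphisms carry small plaques into plaques. -/
theorem samePlaque_of_continuous {A : Type*} [TopologicalSpace A] [PreconnectedSpace A]
    {f : A → P.Solenoid} (hf : Continuous f) (hfV : ∀ a, (f a).1 0 ∈ V) (a b : A) :
    SamePlaque V (f a) (f b) := by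
  obtain ⟨g, hg, hg0, hga⟩ := hV.exists_section (f a) (hfV a)
  refine ⟨g, hg, hg0, ⟨_, hga⟩, ⟨⟨_, hfV b⟩, Subtype.ext (funext fun k => ?_)⟩⟩
  refine coe_eq_of_lift_eq (f := fun a => g ⟨(f a).1 0, hfV a⟩) ?_ hf (fun a => hg0 _)
    (a₀ := a) (by rw [hga]) b
  exact hg.comp (((continuous_coe_apply 0).comp hf).subtype_mk _)

theorem samePlaque_mono {W : Set (P.M 0)} (hW : IsPlaqueDomain W) (hWV : W ⊆ V)
    {t t' : P.Solenoid} (h : SamePlaque W t t') : SamePlaque V t t' := by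
  have := hW.preconnectedSpace
  obtain ⟨g, hg, hg0, ⟨a, rfl⟩, ⟨b, rfl⟩⟩ := h
  exact hV.samePlaque_of_continuous hg (fun a => by rw [hg0]; exact hWV a.2) a b

end IsPlaqueDomain

namespace SolenoidPresentation

variable {n : ℕ} {P : SolenoidPresentation.{u} n}

open Classical in
/-- The point over `w` on the plaque of `t` over `V`. -/
def transport (V : Set (P.M 0)) (w : P.M 0) (t : P.Solenoid) : P.Solenoid :=
  if h : ∃ t', t'.1 0 = w ∧ SamePlaque V t t' then h.choose else t

theorem transport_spec {V : Set (P.M 0)} (hV : IsPlaqueDomain V) {w : P.M 0} (hw : w ∈ V)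
    {t : P.Solenoid} (ht : t.1 0 ∈ V) :
    (transport V w t).1 0 = w ∧ SamePlaque V t (transport V w t) := by
  have h := hV.exists_samePlaque t ht hw
  rw [transport, dif_pos h]
  exact h.choose_spec

/-- Whether two points have the same transport at level `k` depends neither on the end point nor
on the plaque domain. -/
theorem transport_coe_eq_iff {V₁ V₂ V : Set (P.M 0)} (hV₁ : IsPlaqueDomain V₁)
    (hV₂ : IsPlaqueDomain V₂) (hV : IsPlaqueDomain V) (h₁ : V₁ ⊆ V) (h₂ : V₂ ⊆ V) {w₁ w₂ : P.M 0}
    (hw₁ : w₁ ∈ V₁) (hw₂ : w₂ ∈ V₂) {t t' : P.Solenoid} (ht : t.1 0 ∈ V₁ ∩ V₂)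
    (ht' : t'.1 0 ∈ V₁ ∩ V₂) (k : ℕ) :
    (transport V₁ w₁ t).1 k = (transport V₁ w₁ t').1 k ↔
      (transport V₂ w₂ t).1 k = (transport V₂ w₂ t').1 k := by
  have a := transport_spec hV₁ hw₁ ht.1
  have a' := transport_spec hV₁ hw₁ ht'.1
  have b := transport_spec hV₂ hw₂ ht.2
  have b' := transport_spec hV₂ hw₂ ht'.2
  have c := hV.samePlaque_trans (hV.samePlaque_mono hV₁ h₁ a.2).symm (hV.samePlaque_mono hV₂ h₂ b.2)
  have c' := hV.samePlaque_trans (hV.samePlaque_mono hV₁ h₁ a'.2).symm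
    (hV.samePlaque_mono hV₂ h₂ b'.2)
  exact ⟨fun h => hV.coe_eq_of_samePlaque c c' h (b.1.trans b'.1.symm),
    fun h => hV.coe_eq_of_samePlaque c.symm c'.symm h (a.1.trans a'.1.symm)⟩

variable {V : Set (P.M 0)} (hV : IsPlaqueDomain V) {w : P.M 0} (hw : w ∈ V)
include hV hw

theorem transport_eq_of_samePlaque {t t' : P.Solenoid} (h : SamePlaque V t t') :
    transport V w t = transport V w t' := by
  have h1 := transport_spec hV hw h.mem_left
  have h2 := transport_spec hV hw h.mem_right
  refine Subtype.ext (funext fun k => ?_)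
  exact hV.coe_eq_of_samePlaque (hV.samePlaque_trans h.symm h1.2) h2.2 rfl (h1.1.trans h2.1.symm)

theorem transport_eq_self {t : P.Solenoid} (h : t.1 0 = w) : transport V w t = t := by
  have ht : t.1 0 ∈ V := h ▸ hw
  have h1 := transport_spec hV hw ht
  refine Subtype.ext (funext fun k => ?_)
  exact hV.coe_eq_of_samePlaque h1.2 (hV.samePlaque_trans h1.2 h1.2.symm) rfl (h1.1.trans h.symm)

/-- Transport to level `k` is locally constant. -/
theorem isOpen_transport_eq (k : ℕ) (z : P.M k) :
    IsOpen {t : P.Solenoid | t.1 0 ∈ V ∧ (transport V w t).1 k = z} := by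
  rw [isOpen_iff_mem_nhds]
  rintro t ⟨ht, hz⟩
  obtain ⟨g, hg, hg0, hgt⟩ := hV.exists_section t ht
  have hgk : Continuous fun v : V => (g v).1 k := (continuous_coe_apply k).comp hg
  have hcomp : (P.toBase k ∘ fun v : V => (g v).1 k) = Subtype.val :=
    funext fun v => (toBase_coe _ k).trans (hg0 v)
  -- The level-`k` image of the plaque of `t` is open, since followed by the local homeomorphism
  -- `toBase` it is the inclusion of `V`. All points whose level-`k` coordinate lies in it have the
  -- same transport at level `k`.
  have hopen : IsOpen (range fun v : V => (g v).1 k) := by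
    refine IsOpenMap.isOpen_range (IsLocalHomeomorph.isOpenMap ?_)
    refine IsLocalHomeomorph.of_comp ?_ (P.isLocalHomeomorph_toBase k) hgk
    rw [hcomp]
    exact hV.isOpen.isOpenEmbedding_subtypeVal.isLocalHomeomorph
  have hmem : (fun s : P.Solenoid => s.1 k) ⁻¹' (range fun v : V => (g v).1 k) ∈ 𝓝 t :=
    (hopen.preimage (continuous_coe_apply k)).mem_nhds ⟨⟨_, ht⟩, by simp only [hgt]⟩
  refine Filter.mem_of_superset hmem ?_
  rintro s ⟨v, hv⟩
  have hs : s.1 0 = v := by rw [← hg0 v]; exact (coe_eq_of_le k.zero_le hv).symm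
  have hsV : s.1 0 ∈ V := hs ▸ v.2
  refine ⟨hsV, hz ▸ ?_⟩
  have h1 := transport_spec hV hw hsV
  have h2 := transport_spec hV hw ht
  exact hV.coe_eq_of_samePlaque h1.2
    (hV.samePlaque_trans ⟨g, hg, hg0, ⟨v, rfl⟩, ⟨_, hgt⟩⟩ h2.2) hv.symm (h1.1.trans h2.1.symm)

end SolenoidPresentation

/-! ### Comparing two solenoids along a homeomorphism -/

theorem isLocallyConstant_of_finite_range {K X : Type*} [TopologicalSpace K] [TopologicalSpace X]
    [T1Space X] {f : K → X} (hf : Continuous f) (hfin : (range f).Finite) :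
    IsLocallyConstant f := by
  intro s
  have : f ⁻¹' s = (f ⁻¹' (range f \ s))ᶜ := by
    ext
    simp
  rw [this]
  exact ((hfin.subset sdiff_subset).isClosed.preimage hf).isOpen_compl

theorem IsLocallyConstant.isOpen_setOf_eq {K X : Type*} [TopologicalSpace K] {f : K → X}
    (hf : IsLocallyConstant f) : IsOpen {p : K × K | f p.1 = f p.2} := by
  have : {p : K × K | f p.1 = f p.2} = ⋃ e, (f ⁻¹' {e}) ×ˢ (f ⁻¹' {e}) := by
    ext p
    simp [eq_comm]
  rw [this]
  exact isOpen_iUnion fun e => (hf _).prod (hf _)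

namespace SolenoidPresentation

section Basic

variable {n : ℕ} {P : SolenoidPresentation.{u} n}

theorem exists_fiber_subset (s : P.Solenoid) {U : Set P.Solenoid} (hU : IsOpen U) (hs : s ∈ U) :
    ∃ k₀, ∀ k ≥ k₀, ∀ t : P.Solenoid, t.1 k = s.1 k → t ∈ U := by
  obtain ⟨k₀, hk₀⟩ := exists_forall_eq_imp_mem (fun k (t : P.Solenoid) => t.1 k)
    continuous_coe_apply (fun k c c' h => coe_eq_of_le k.le_succ h)
    -- This open relation encodes the implication `c = s → c' ∈ U`.
    ({s}ᶜ ×ˢ univ ∪ univ ×ˢ U)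
    ((isOpen_compl_singleton.prod isOpen_univ).union (isOpen_univ.prod hU)) (by
      intro c c' h
      obtain rfl : c = c' := Subtype.ext (funext h)
      by_cases hc : c = s
      · exact Or.inr ⟨mem_univ _, hc ▸ hs⟩
      · exact Or.inl ⟨hc, mem_univ _⟩)
  refine ⟨k₀, fun k hk t ht => ?_⟩
  rcases hk₀ k hk s t ht.symm with h | h
  · exact absurd rfl h.1
  · exact h.2

/-- The tube lemma for the projection of the solenoid to level `l`. -/
theorem exists_isOpen_preimage_subset {l : ℕ} {y : P.M l} {U : Set P.Solenoid} (hU : IsOpen U)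
    (hy : ∀ t : P.Solenoid, t.1 l = y → t ∈ U) :
    ∃ O : Set (P.M l), IsOpen O ∧ y ∈ O ∧ ∀ t : P.Solenoid, t.1 l ∈ O → t ∈ U := by
  have hc : IsClosed ((fun t : P.Solenoid => t.1 l) '' Uᶜ) :=
    (hU.isClosed_compl.isCompact.image (continuous_coe_apply l)).isClosed
  refine ⟨_, hc.isOpen_compl, ?_, fun t ht => ?_⟩
  · rintro ⟨t, ht, hty⟩
    exact ht (hy t hty)
  · by_contra htU
    exact ht ⟨t, htU, rfl⟩

theorem totalDegree_dvd_of_le {k l : ℕ} (h : k ≤ l) : P.totalDegree k ∣ P.totalDegree l :=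
  Finset.prod_dvd_prod_of_subset _ _ _ (Finset.range_mono h)

theorem exists_isPlaqueDomain {l : ℕ} (y : P.M l) {U : Set (P.M l)} (hU : U ∈ 𝓝 y) :
    ∃ V, IsPlaqueDomain V ∧ y ∈ V ∧ V ⊆ U :=
  exists_isPlaqueDomain_subset (n := n) y hU

end Basic

variable {n n' : ℕ} {P : SolenoidPresentation.{u} n} {P' : SolenoidPresentation.{v} n'}

/-- The number of plaques at level `k` of the second solenoid that meet the image of a fiber of the
first solenoid over level `l` does not depend on the fiber. -/
theorem exists_ncard_transport_eq (h : P.Solenoid ≃ₜ P'.Solenoid) {𝒲 : Set (Set (P'.M 0))}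
    (hnice : ∀ W ∈ 𝒲, IsPlaqueDomain W)
    (hpair : ∀ W₁ ∈ 𝒲, ∀ W₂ ∈ 𝒲, (W₁ ∩ W₂).Nonempty → ∃ V, IsPlaqueDomain V ∧ W₁ ⊆ V ∧ W₂ ⊆ V)
    (l k : ℕ) (hcov : ∀ y, ∃ W ∈ 𝒲, ∀ c : P.Solenoid, c.1 l = y → (h c).1 0 ∈ W) :
    ∃ N : ℕ, ∀ y, ∀ W ∈ 𝒲, ∀ w ∈ W, (∀ c : P.Solenoid, c.1 l = y → (h c).1 0 ∈ W) →
      ((fun c => (transport W w (h c)).1 k) '' {c : P.Solenoid | c.1 l = y}).ncard = N := by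
  choose W hW hWc using hcov
  have hw : ∀ y, ∃ w, w ∈ W y := fun y => by
    obtain ⟨c, hc⟩ := exists_coe_eq (P := P) l y
    exact ⟨_, hWc y c hc⟩
  choose w hw using hw
  let N : P.M l → ℕ := fun y =>
    ((fun c => (transport (W y) (w y) (h c)).1 k) '' {c : P.Solenoid | c.1 l = y}).ncard
  have hN : ∀ y, ∀ W' ∈ 𝒲, ∀ w' ∈ W', (∀ c : P.Solenoid, c.1 l = y → (h c).1 0 ∈ W') →
      ((fun c => (transport W' w' (h c)).1 k) '' {c : P.Solenoid | c.1 l = y}).ncard = N y := by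
    intro y W' hW' w' hw' hc
    obtain ⟨c₀, hc₀⟩ := exists_coe_eq (P := P) l y
    obtain ⟨V, hV, hV₁, hV₂⟩ := hpair W' hW' (W y) (hW y) ⟨_, hc c₀ hc₀, hWc y c₀ hc₀⟩
    refine ncard_image_eq_of_eq_iff _ _ _ fun c hcy c' hcy' => ?_
    exact transport_coe_eq_iff (hnice _ hW') (hnice _ (hW y)) hV hV₁ hV₂ hw' (hw y)
      ⟨hc c hcy, hWc y c hcy⟩ ⟨hc c' hcy', hWc y c' hcy'⟩ k
  have hconst : IsLocallyConstant N := by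
    rw [IsLocallyConstant.iff_exists_open]
    intro y
    have hWy := hnice _ (hW y)
    obtain ⟨O₁, hO₁, hy₁, hO₁W⟩ := exists_isOpen_preimage_subset (P := P) (l := l) (y := y)
      (U := {c | (h c).1 0 ∈ W y})
      (hWy.isOpen.preimage ((continuous_coe_apply 0).comp h.continuous)) (hWc y)
    obtain ⟨O, hO, hy, hOO₁⟩ := exists_isPlaqueDomain (P := P) y (hO₁.mem_nhds hy₁)
    refine ⟨O, hO.isOpen, hy, fun y' hy' => ?_⟩
    rw [← hN y' (W y) (hW y) (w y) (hw y) (fun c hc => hO₁W c (hOO₁ (hc ▸ hy')))]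
    -- Sliding along a section over `O` moves the fiber over `a` to the fiber over `b`, while `h`
    -- keeps each point in its plaque over `W y`, so both fibers meet the same plaques.
    have key : ∀ a ∈ O, ∀ b ∈ O,
        (fun c => (transport (W y) (w y) (h c)).1 k) '' {c : P.Solenoid | c.1 l = a} ⊆
        (fun c => (transport (W y) (w y) (h c)).1 k) '' {c : P.Solenoid | c.1 l = b} := by
      rintro a ha b hb _ ⟨c, hc, rfl⟩
      obtain rfl : c.1 l = a := hc
      obtain ⟨g, hg, hgl, hgc⟩ := hO.exists_section c ha
      have := hO.preconnectedSpace
      have hpl := hWy.samePlaque_of_continuous (h.continuous.comp hg)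
        (fun v => hO₁W _ (hOO₁ (by rw [hgl]; exact v.2))) ⟨_, hb⟩ ⟨_, ha⟩
      refine ⟨g ⟨b, hb⟩, hgl _, ?_⟩
      have := transport_eq_of_samePlaque hWy (hw y) hpl
      simp only [Function.comp, hgc] at this
      simp only [this]
    rw [(key y' hy' y hy).antisymm (key y hy y' hy')]
  obtain ⟨y₀⟩ := (inferInstance : Nonempty (P.M l))
  refine ⟨N y₀, fun y W' hW' w' hw' hc => ?_⟩
  rw [hN y W' hW' w' hw' hc]
  exact hconst.apply_eq_of_isPreconnected isPreconnected_univ (mem_univ _) (mem_univ _)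

/-- A double count of the image of `T` at level `k`. The constant `c` depends only on the level from
which `T` is a union of fibers, not on `l`. -/
theorem exists_totalDegree_dvd (h : P.Solenoid ≃ₜ P'.Solenoid) :
    ∃ c > 0, ∀ l, ∃ k, P.totalDegree l ∣ c * P'.totalDegree k := by
  obtain ⟨𝒲, hnice, hbasis, hpair, R, hR, hRdiag, hRW⟩ :=
    exists_fine_family_isPlaqueDomain n' (P'.M 0)
  have hcont : Continuous fun c : P.Solenoid => (h c).1 0 :=
    (continuous_coe_apply 0).comp h.continuous
  obtain ⟨l₀, hl₀⟩ := exists_forall_eq_imp_mem (fun k (t : P.Solenoid) => t.1 k)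
    continuous_coe_apply (fun k c c' h => coe_eq_of_le k.le_succ h)
    ((fun p : P.Solenoid × P.Solenoid => ((h p.1).1 0, (h p.2).1 0)) ⁻¹' R)
    (hR.preimage ((hcont.comp continuous_fst).prodMk (hcont.comp continuous_snd))) (by
      intro c c' hcc
      obtain rfl : c = c' := Subtype.ext (funext hcc)
      exact hRdiag _)
  have hcov : ∀ l ≥ l₀, ∀ y, ∃ W ∈ 𝒲, ∀ c : P.Solenoid, c.1 l = y → (h c).1 0 ∈ W := by
    intro l hl y
    obtain ⟨c₀, hc₀⟩ := exists_coe_eq (P := P) l y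
    obtain ⟨W, hW, hWR⟩ := hRW ((h c₀).1 0)
    exact ⟨W, hW, fun c hc => hWR _ (hl₀ l hl c₀ c (hc₀.trans hc.symm))⟩
  obtain ⟨s⟩ := (inferInstance : Nonempty P.Solenoid)
  obtain ⟨O, hO, hsO, -⟩ := exists_isPlaqueDomain (P := P) (s.1 0) Filter.univ_mem
  -- plaques near `h s` are mapped by `h.symm` into plaques over `O`
  have hN : IsOpen {t : P'.Solenoid | (h.symm t).1 0 ∈ O} :=
    hO.isOpen.preimage ((continuous_coe_apply 0).comp h.symm.continuous)
  obtain ⟨k₁, hk₁⟩ := exists_fiber_subset (h s) hN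
    (show (h.symm (h s)).1 0 ∈ O by rwa [h.symm_apply_apply])
  obtain ⟨V₁, hV₁, hsV₁, hV₁N⟩ := exists_isOpen_preimage_subset hN (hk₁ k₁ le_rfl)
  obtain ⟨V, hV, hsV, -⟩ := exists_isPlaqueDomain (P := P') ((h s).1 0) Filter.univ_mem
  obtain ⟨g, hg, hg0, hgs⟩ := hV.exists_section (h s) hsV
  -- `W` is shrunk so that the part over `W` of the plaque of `h s` has its level-`k₁` coordinates
  -- in `V₁`. By `hplaque`, any plaque over `W` agreeing with it at level `k₁` is then sent by
  -- `h.symm` over `O`.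
  have hWnhds : Subtype.val '' ((fun v : V => (g v).1 k₁) ⁻¹' V₁) ∈ 𝓝 ((h s).1 0) := by
    refine (hV.isOpen.isOpenMap_subtype_val _
      (hV₁.preimage ((continuous_coe_apply k₁).comp hg))).mem_nhds ⟨⟨_, hsV⟩, ?_, rfl⟩
    simpa only [mem_preimage, Function.comp, hgs] using hsV₁
  obtain ⟨W, hW𝒲, hsW, hWV⟩ := hbasis _ _ hWnhds
  have hW := hnice W hW𝒲
  have hWV' : W ⊆ V := fun v hv => by
    obtain ⟨a, -, rfl⟩ := hWV hv
    exact a.2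
  let tr : P'.Solenoid → P'.Solenoid := transport W ((h s).1 0)
  have htr : ∀ t : P'.Solenoid, t.1 0 ∈ W → (tr t).1 0 = (h s).1 0 ∧ SamePlaque W t (tr t) :=
    fun t ht => transport_spec hW hsW ht
  have hplaque : ∀ t t' : P'.Solenoid, SamePlaque W t t' → (tr t).1 k₁ = (h s).1 k₁ →
      (h.symm t').1 0 ∈ O := by
    intro t t' htt' htk
    obtain ⟨a, ha, hat⟩ := hWV htt'.mem_right
    have h1 : SamePlaque V (tr t) t' := hV.samePlaque_mono hW hWV'
      (hW.samePlaque_trans (htr t htt'.mem_left).2.symm htt')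
    have h2 : SamePlaque V (h s) (g a) := ⟨g, hg, hg0, ⟨_, hgs⟩, ⟨_, rfl⟩⟩
    have h3 := hV.coe_eq_of_samePlaque h1 h2 htk (hat.symm.trans (hg0 a).symm)
    exact hV₁N t' (h3 ▸ ha)
  have hWopen : IsOpen {c : P.Solenoid | (h c).1 0 ∈ W} := hW.isOpen.preimage hcont
  obtain ⟨l₀', hl₀'⟩ := exists_fiber_subset s hWopen hsW
  let L := max l₀ l₀'
  have hLW : ∀ c : P.Solenoid, c.1 L = s.1 L → (h c).1 0 ∈ W := hl₀' L (le_max_right _ _)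
  obtain ⟨O₁, hO₁, hsO₁, hO₁W⟩ := exists_isOpen_preimage_subset hWopen hLW
  obtain ⟨O', hO', hsO', hO'O₁⟩ := exists_isPlaqueDomain (P := P) (s.1 L) (hO₁.mem_nhds hsO₁)
  obtain ⟨k₂', hk₂'⟩ := exists_fiber_subset (h s) (U := {t | (h.symm t).1 L ∈ O'})
    (hO'.isOpen.preimage ((continuous_coe_apply L).comp h.symm.continuous))
    (show (h.symm (h s)).1 L ∈ O' by rwa [h.symm_apply_apply])
  let k₂ := max k₁ k₂'
  -- Level `k₂ ≥ k₁` makes `hplaque` available, for injectivity on `T`; `k₂ ≥ k₂'` puts the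
  -- preimages of the points near `h s` over `O'`, whence they slide into the fiber of `s`, for
  -- surjectivity.
  let T : Set P.Solenoid := {c | c.1 L = s.1 L ∧ (tr (h c)).1 k₂ = (h s).1 k₂}
  have hTW : ∀ c ∈ T, (h c).1 0 ∈ W := fun c hc => hLW c hc.1
  -- the image of `T` meets exactly the plaques near `h s`
  have himage : ∀ k, (fun c => (tr (h c)).1 k) '' T
      = (fun t : P'.Solenoid => t.1 k) '' {t | t.1 k₂ = (h s).1 k₂} := by
    intro k
    ext z
    constructor
    · rintro ⟨c, hc, rfl⟩
      exact ⟨tr (h c), hc.2, rfl⟩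
    · rintro ⟨t, ht, rfl⟩
      have htO' : (h.symm t).1 L ∈ O' := hk₂' k₂ (le_max_right _ _) t ht
      obtain ⟨f, hf, hfL, hft⟩ := hO'.exists_section (h.symm t) htO'
      have := hO'.preconnectedSpace
      have hpl := hW.samePlaque_of_continuous (h.continuous.comp hf)
        (fun v => hO₁W _ (hO'O₁ (by rw [hfL]; exact v.2))) ⟨_, hsO'⟩ ⟨_, htO'⟩
      simp only [Function.comp, hft, h.apply_symm_apply] at hpl
      have h1 : tr (h (f ⟨_, hsO'⟩)) = t :=
        (transport_eq_of_samePlaque hW hsW hpl).trans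
          (transport_eq_self hW hsW (coe_eq_of_le k₂.zero_le ht))
      exact ⟨f ⟨_, hsO'⟩, ⟨hfL _, h1.symm ▸ ht⟩, by simp only [h1]⟩
  -- Equal transports put `h c` and `h c'` on one plaque over `W`. Its preimage lies in a plaque
  -- over `O`, which has only one point over the common base point of `c` and `c'`.
  have hinj : ∀ c ∈ T, ∀ c' ∈ T, tr (h c) = tr (h c') → c = c' := by
    intro c hc c' hc' hcc
    have hpl : SamePlaque W (h c) (h c') :=
      hW.samePlaque_trans (htr _ (hTW c hc)).2 (hcc ▸ (htr _ (hTW c' hc')).2.symm)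
    obtain ⟨f, hf, hf0, ⟨a, ha⟩, ⟨b, hb⟩⟩ := hpl
    have := hW.preconnectedSpace
    have hO1 := hO.samePlaque_of_continuous (h.symm.continuous.comp hf)
      (fun v => hplaque (h c) (f v) ⟨f, hf, hf0, ⟨a, ha⟩, ⟨v, rfl⟩⟩
        (coe_eq_of_le (le_max_left _ _) hc.2)) a b
    simp only [Function.comp, ha, hb, h.symm_apply_apply] at hO1
    refine Subtype.ext (funext fun k => ?_)
    exact hO.coe_eq_of_samePlaque (hO.samePlaque_trans hO1 hO1.symm) hO1 rfl
      (coe_eq_of_le L.zero_le (hc.1.trans hc'.1.symm))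
  have hopen : ∀ k z, IsOpen {c : P.Solenoid | (h c).1 0 ∈ W ∧ (tr (h c)).1 k = z} := fun k z =>
    (isOpen_transport_eq hW hsW k z).preimage h.continuous
  have hTclosed : IsClosed T := by
    have : T = {c | c.1 L = s.1 L} ∩ (⋃ z ∈ ({(h s).1 k₂}ᶜ : Set (P'.M k₂)),
        {c : P.Solenoid | (h c).1 0 ∈ W ∧ (tr (h c)).1 k₂ = z})ᶜ := by
      ext c
      simp only [mem_inter_iff, mem_compl_iff, mem_iUnion]
      constructor
      · rintro hc
        refine ⟨hc.1, ?_⟩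
        rintro ⟨z, hz, -, rfl⟩
        exact hz hc.2
      · rintro ⟨hc, hc'⟩
        refine ⟨hc, ?_⟩
        by_contra hne
        exact hc' ⟨_, hne, hLW c hc, rfl⟩
    rw [this]
    exact (isClosed_eq (continuous_coe_apply L) continuous_const).inter
      (isOpen_biUnion fun z _ => hopen k₂ z).isClosed_compl
  obtain ⟨l₁', hl₁'⟩ := exists_forall_eq_imp_mem (fun k (t : P.Solenoid) => t.1 k)
    continuous_coe_apply (fun k c c' h => coe_eq_of_le k.le_succ h)
    -- The implication `c ∈ T → c'` satisfies the open condition defining `T`; beyond level `L` this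
    -- makes `T` a union of fibers.
    (Tᶜ ×ˢ univ ∪ univ ×ˢ {c : P.Solenoid | (h c).1 0 ∈ W ∧ (tr (h c)).1 k₂ = (h s).1 k₂})
    ((hTclosed.isOpen_compl.prod isOpen_univ).union (isOpen_univ.prod (hopen _ _))) (by
      intro c c' hcc
      obtain rfl : c = c' := Subtype.ext (funext hcc)
      by_cases hc : c ∈ T
      · exact Or.inr ⟨mem_univ _, hTW c hc, hc.2⟩
      · exact Or.inl ⟨hc, mem_univ _⟩)
  let l₁ := max L l₁'
  have hsat : ∀ l ≥ l₁, ∀ c ∈ T, ∀ c' : P.Solenoid, c'.1 l = c.1 l → c' ∈ T := by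
    intro l hl c hc c' hcc
    rcases hl₁' l ((le_max_right _ _).trans hl) c c' hcc.symm with h1 | h1
    · exact absurd hc h1.1
    · exact ⟨(coe_eq_of_le ((le_max_left _ _).trans hl) hcc).trans hc.1, h1.2.2⟩
  have hTfin : ∀ l ≥ L, ((fun c : P.Solenoid => c.1 l) '' T).Finite := fun l hl =>
    (ncard_fiber hl (s.1 L)).1.subset (image_mono fun c hc => hc.1)
  have : CompactSpace T := isCompact_iff_compactSpace.1 hTclosed.isCompact
  -- By injectivity the transported coordinates separate the points of the compact set `T`. The
  -- level-`l` coordinate takes finitely many values on `T`, so its equality relation is open, and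
  -- one level `k₀` already determines it.
  have hsep : ∀ l ≥ L, ∃ k₀, ∀ k ≥ k₀, ∀ c ∈ T, ∀ c' ∈ T,
      (tr (h c)).1 k = (tr (h c')).1 k → c.1 l = c'.1 l := by
    intro l hl
    have hlc : IsLocallyConstant fun c : T => c.1.1 l := by
      refine isLocallyConstant_of_finite_range
        ((continuous_coe_apply l).comp continuous_subtype_val) ((hTfin l hl).subset ?_)
      rintro _ ⟨c, rfl⟩
      exact ⟨c, c.2, rfl⟩
    obtain ⟨k₀, hk₀⟩ := exists_forall_eq_imp_mem (fun k (c : T) => (tr (h c)).1 k)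
      (fun k => IsLocallyConstant.continuous fun U => by
        have : (fun c : T => (tr (h c)).1 k) ⁻¹' U = ⋃ z ∈ U, Subtype.val ⁻¹'
            {c : P.Solenoid | (h c).1 0 ∈ W ∧ (tr (h c)).1 k = z} := by
          ext c
          simp only [mem_iUnion]
          constructor
          · intro hc
            exact ⟨_, hc, hTW c c.2, rfl⟩
          · rintro ⟨z, hz, -, rfl⟩
            exact hz
        rw [this]
        exact isOpen_biUnion fun z _ => (hopen k z).preimage continuous_subtype_val)
      (fun k c c' h => coe_eq_of_le k.le_succ h) _ hlc.isOpen_setOf_eq (by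
        intro c c' hcc
        obtain rfl : c = c' := Subtype.ext (hinj c c.2 c' c'.2 (Subtype.ext (funext hcc)))
        rfl)
    exact ⟨k₀, fun k hk c hc c' hc' hcc => hk₀ k hk ⟨c, hc⟩ ⟨c', hc'⟩ hcc⟩
  refine ⟨P.totalDegree l₁, P.totalDegree_pos _, fun l' => ?_⟩
  let l := max l' l₁
  have hl₁ : l₁ ≤ l := le_max_right _ _
  have hLl : L ≤ l := (le_max_left _ _).trans hl₁
  obtain ⟨k₀, hk₀⟩ := hsep l hLl
  let k := max k₀ k₂
  obtain ⟨N, hNcard⟩ := exists_ncard_transport_eq h hnice hpair l k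
    (hcov l ((le_max_left _ _).trans hLl))
  have hA := ncard_fiber (P := P') (le_max_right k₀ k₂) ((h s).1 k₂)
  rw [← himage] at hA
  -- Group the level-`k` points by the level-`l` coordinate of `c`. Each group comes from a full
  -- fiber over `M l`, as `T` is saturated, so it has `N` elements.
  have hAN := ncard_image_eq_mul T (fun c => (tr (h c)).1 k) (fun c => c.1 l) N hA.1
    (hk₀ k (le_max_left _ _)) (by
      rintro e ⟨c, hc, rfl⟩
      have : T ∩ (fun c : P.Solenoid => c.1 l) ⁻¹' {c.1 l} = {c' | c'.1 l = c.1 l} := by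
        ext c'
        exact ⟨fun hc' => hc'.2, fun hc' => ⟨hsat l hl₁ c hc c' hc', hc'⟩⟩
      rw [this]
      exact hNcard _ W hW𝒲 _ hsW fun c' hc' => hTW c' (hsat l hl₁ c hc c' hc'))
  have hB := ncard_image_eq_mul T (fun c => c.1 l) (fun c => c.1 l₁)
    (P.totalDegree l / P.totalDegree l₁) (hTfin l hLl)
    (fun c _ c' _ hcc => coe_eq_of_le hl₁ hcc) (by
      rintro e ⟨c, hc, rfl⟩
      have : T ∩ (fun c : P.Solenoid => c.1 l₁) ⁻¹' {c.1 l₁} = {c' | c'.1 l₁ = c.1 l₁} := by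
        ext c'
        exact ⟨fun hc' => hc'.2, fun hc' => ⟨hsat l₁ le_rfl c hc c' hc', hc'⟩⟩
      rw [this]
      exact Nat.eq_div_of_mul_eq_left (P.totalDegree_pos l₁).ne' (ncard_fiber hl₁ _).2)
  refine ⟨k, (totalDegree_dvd_of_le (le_max_left l' l₁)).trans ?_⟩
  have hdiv : P.totalDegree l / P.totalDegree l₁ * P.totalDegree l₁ = P.totalDegree l :=
    Nat.div_mul_cancel (totalDegree_dvd_of_le hl₁)
  refine ⟨((fun c : P.Solenoid => c.1 l₁) '' T).ncard * N * P'.totalDegree k₂, ?_⟩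
  rw [← hA.2, hAN, hB]
  conv_rhs => rw [← hdiv]
  ring

end SolenoidPresentation

/-! ### From divisibility to prime spectra -/

namespace SteinitzNumber

theorem infinitePrimeSpectrum_subset {ξ ξ' : SteinitzNumber} {c : ℕ} (hc : 0 < c)
    (h : ∀ p : Nat.Primes, ξ.χ p ≤ emultiplicity (p : ℕ) c + ξ'.χ p) :
    ξ.infinitePrimeSpectrum ⊆ ξ'.infinitePrimeSpectrum := by
  intro p hp
  have h1 := h p
  rw [show ξ.χ p = ⊤ from hp, top_le_iff] at h1
  refine (WithTop.add_eq_top.1 h1).resolve_left (finiteMultiplicity_iff_emultiplicity_ne_top.1 ?_)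
  exact Nat.finiteMultiplicity_iff.2 ⟨p.2.ne_one, hc⟩

/-- The two exponents coincide at every prime not dividing `c * c'`, and only finitely many primes
are excluded. -/
theorem infinite_finitePrimeSpectrum {ξ ξ' : SteinitzNumber} {c c' : ℕ} (hc : 0 < c)
    (hc' : 0 < c') (h : ∀ p : Nat.Primes, ξ.χ p ≤ emultiplicity (p : ℕ) c + ξ'.χ p)
    (h' : ∀ p : Nat.Primes, ξ'.χ p ≤ emultiplicity (p : ℕ) c' + ξ.χ p)
    (hinf : ξ.finitePrimeSpectrum.Infinite) : ξ'.finitePrimeSpectrum.Infinite := by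
  have hfin : {p : Nat.Primes | (p : ℕ) ∣ c * c'}.Finite := by
    refine Set.Finite.of_finite_image ((Nat.divisors (c * c')).finite_toSet.subset ?_)
      (Set.injOn_of_injective (f := ((↑) : Nat.Primes → ℕ)) Subtype.val_injective)
    rintro _ ⟨p, hp, rfl⟩
    exact Nat.mem_divisors.2 ⟨hp, (Nat.mul_pos hc hc').ne'⟩
  refine (hinf.sdiff hfin).mono ?_
  rintro p ⟨hp, hpc⟩
  have h1 : ¬ (p : ℕ) ∣ c := fun hd => hpc (hd.mul_right c')
  have h2 : ¬ (p : ℕ) ∣ c' := fun hd => hpc (hd.mul_left c)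
  have heq : ξ.χ p = ξ'.χ p := by
    refine le_antisymm ((h p).trans_eq ?_) ((h' p).trans_eq ?_)
    · rw [emultiplicity_eq_zero.2 h1, zero_add]
    · rw [emultiplicity_eq_zero.2 h2, zero_add]
  exact show 0 < ξ'.χ p ∧ ξ'.χ p < ⊤ from heq ▸ hp

end SteinitzNumber

theorem SolenoidPresentation.exists_steinitzOrder_le {n n' : ℕ} {P : SolenoidPresentation.{u} n}
    {P' : SolenoidPresentation.{v} n'} (h : P.Solenoid ≃ₜ P'.Solenoid) :
    ∃ c > 0, ∀ p : Nat.Primes,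
      P.steinitzOrder.χ p ≤ emultiplicity (p : ℕ) c + P'.steinitzOrder.χ p := by
  obtain ⟨c, hc, hdvd⟩ := exists_totalDegree_dvd h
  refine ⟨c, hc, fun p => iSup_le fun l => ?_⟩
  obtain ⟨k, hk⟩ := hdvd l
  refine (emultiplicity_le_emultiplicity_of_dvd_right hk).trans ?_
  rw [emultiplicity_mul p.2.prime]
  gcongr
  exact le_iSup (fun k => emultiplicity (p : ℕ) (P'.totalDegree k)) k

end

theorem corollary7p4 {n n' : ℕ} (P : SolenoidPresentation.{u} n)
    (P' : SolenoidPresentation.{v} n') (h : Nonempty (P.Solenoid ≃ₜ P'.Solenoid)) :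
    P.steinitzOrder.infinitePrimeSpectrum = P'.steinitzOrder.infinitePrimeSpectrum ∧
      (P.steinitzOrder.finitePrimeSpectrum.Infinite ↔
        P'.steinitzOrder.finitePrimeSpectrum.Infinite) := by
  obtain ⟨h⟩ := h
  obtain ⟨c, hc, hle⟩ := SolenoidPresentation.exists_steinitzOrder_le h
  obtain ⟨c', hc', hle'⟩ := SolenoidPresentation.exists_steinitzOrder_le h.symm
  exact ⟨(SteinitzNumber.infinitePrimeSpectrum_subset hc hle).antisymm
      (SteinitzNumber.infinitePrimeSpectrum_subset hc' hle'),
    SteinitzNumber.infinite_finitePrimeSpectrum hc hc' hle hle',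
    SteinitzNumber.infinite_finitePrimeSpectrum hc' hc hle' hle⟩
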